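/- **Setting.** Let $1\le U\le K$. In slots $t=1,2,\dots$ there are $U$ queues and $K$ servers. Arrivals $A_u(t)\in\{0,1\}$ (mean $\lambda_u\in[0,1]$) and potential services $R_{uk}(t)\in\{0,1\}$ (mean $\mu_{uk}\in[0,1]$) are Bernoulli, independent over all indices and slots. A problem instance $(\boldsymbol\lambda,\boldsymbol\mu)$ is required to have a unique optimal matching that stabilizes every queue: each queue $u$ has a unique best server $k_u^*=\arg\max_k\mu_{uk}$, with rate $\mu_u^*=\mu_{uk_u^*}$; $k_u^*\ne k_{u'}^*$ for $u\ne u'$; and $\lambda_u<\mu_u^*$ for all $u$. A scheduling policy chooses in every slot $t$, possibly at random and without knowing the instance, a matching of queues and servers (each queue gets at most one server and each server at most one queue) on the basis of the arrivals, the chosen matchings and the services offered by the assigned servers in slots $1,\dots,t-1$. Write $\kappa_u(t)$ for the server assigned to queue $u$ (if any), and $S_u(t)=R_{u\kappa_u(t)}(t)$ for the service offered to it ($0$ if no server is assigned). The queue lengths are $Q_u(t)=(Q_u(t-1)+A_u(t)-S_u(t))^+$, and those of the policy that always uses the optimal matching are $Q^*_u(t)=(Q^*_u(t-1)+A_u(t)-R_{uk_u^*}(t))^+$.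 Both systems start from $Q_u(0)=Q_u^*(0)$, distributed according to the stationary distribution of $Q_u^*$ and independent of the arrivals, services and decisions. The queue-regret is $\Psi_u(t)=\mathbb E[Q_u(t)-Q_u^*(t)]$. For $\alpha\in(0,1)$ the policy is $\alpha$-consistent if for every problem instance, every $u$ and every $k\ne k_u^*$, $\mathbb E\big[\sum_{s=1}^t \mathbf 1\{\kappa_u(s)=k\}\big]=O(t^\alpha)$ as $t\to\infty$. Let $\Delta=\min_{u,\,k\ne k_u^*}(\mu_u^*-\mu_{uk})$, let $\mu_{\min},\mu_{\max}$ be the minimum and maximum of all $\mu_{uk}$, let $\lambda_{\min}=\min_u\lambda_u$, let $\mathrm{KL}(p,q)$ be the Kullback–Leibler divergence between the Bernoulli distributions of means $p$ and $q$, and let $$D(\boldsymbol\mu)=\frac{\Delta}{\mathrm{KL}\left(\mu_{\min},\frac{\mu_{\max}+1}{2}\right)},$$ with $\Delta/\infty=0$ (if $K=1$ then $\Delta$ is a minimum over the empty set, and $D(\boldsymbol\mu)$ is set to $0$; it is then multiplied by $0$ below). **Theorem.** For every problem instance $(\boldsymbol\lambda,\boldsymbol\mu)$, every $\alpha\in(0,1)$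 and every $\alpha$-consistent policy: (a) for infinitely many $t$, $$\frac1U\sum_{u=1}^U\Psi_u(t)\ \ge\ \Big(\frac{\lambda_{\min}}{8}\,D(\boldsymbol\mu)\,(1-\alpha)\,(K-1)\Big)\frac1t;$$ (b) for every queue $u$, for infinitely many $t$, $$\Psi_u(t)\ \ge\ \Big(\frac{\lambda_{\min}}{8}\,D(\boldsymbol\mu)\,(1-\alpha)\,\max\{U-1,\,2(K-U)\}\Big)\frac1t.$$ (c) In particular, for a single queue ($U=1$, with $\lambda=\lambda_1$, $\Psi=\Psi_1$ and $\mu_{\max}=\mu^*$), for infinitely many $t$, $$\Psi(t)\ \ge\ \Big(\frac{\lambda}{4}\,D(\boldsymbol\mu)\,(1-\alpha)\,(K-1)\Big)\frac1t .$$ -/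

import Mathlib

open Filter Asymptotics
open scoped ENNReal

noncomputable section

namespace QueueingBandit

/-- The Bernoulli law of mean `p`, on `Bool` (`true` is the value one). -/
def coin (p : unitInterval) : PMF Bool :=
  PMF.ofFintype (fun b => if b then ENNReal.ofReal p else ENNReal.ofReal (1 - p)) (by
    rw [Fintype.sum_bool]
    simp only [if_true, Bool.false_eq_true, if_false]
    rw [← ENNReal.ofReal_add p.2.1 (sub_nonneg.2 p.2.2)]
    simp)

/-- The product Bernoulli law with means `p i`. -/
def coins {ι : Type} [Fintype ι] [DecidableEq ι] (p : ι → unitInterval) : PMF (ι → Bool) :=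
  PMF.ofFintype (fun x => ∏ i, coin (p i) (x i)) (by
    rw [← Fintype.prod_sum fun i b => coin (p i) b]
    refine Finset.prod_eq_one fun i _ => ?_
    exact (tsum_fintype _).symm.trans (coin (p i)).tsum_coe)

/-- Expectation of a real function under a discrete law. -/
def expect {Ω : Type} (p : PMF Ω) (f : Ω → ℝ) : ℝ := ∑' x, (p x).toReal * f x

/-- A problem instance with `U` queues and `K` servers: Bernoulli arrival rates and service rates,
a unique best server for each queue, distinct queues having distinct best servers, and every queue
stable when it is served by its best server. -/
structure Instance (U K : ℕ) where
  /-- arrival rate of each queue -/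
  lam : Fin U → unitInterval
  /-- service rate of each queue-server pair -/
  mu : Fin U → Fin K → unitInterval
  /-- the best server of each queue -/
  best : Fin U → Fin K
  mu_lt_best : ∀ u k, k ≠ best u → mu u k < mu u (best u)
  best_injective : Function.Injective best
  stable : ∀ u, lam u < mu u (best u)

namespace Instance

variable {U K : ℕ} (I : Instance U K)

/-- The largest service rate of queue `u`. -/
def muStar (u : Fin U) : ℝ := I.mu u (I.best u)

/-- The smallest gap between the best server of a queue and another server. -/
def gap : ℝ :=
  ⨅ p : {p : Fin U × Fin K // p.2 ≠ I.best p.1}, (I.muStar p.1.1 - I.mu p.1.1 p.1.2)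

def muMin : ℝ := ⨅ p : Fin U × Fin K, (I.mu p.1 p.2 : ℝ)

def muMax : ℝ := ⨆ p : Fin U × Fin K, (I.mu p.1 p.2 : ℝ)

def lamMin : ℝ := ⨅ u : Fin U, (I.lam u : ℝ)

end Instance

/-- The Kullback-Leibler divergence between the Bernoulli laws of means `p` and `q`
(with `0 log 0 = 0`; it is infinite when absolute continuity fails). -/
def bernKL (p q : ℝ) : ℝ≥0∞ :=
  if (q = 0 ∧ p ≠ 0) ∨ (q = 1 ∧ p ≠ 1) then ⊤
  else ENNReal.ofReal (p * Real.log (p / q) + (1 - p) * Real.log ((1 - p) / (1 - q)))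

/-- `D(μ) = Δ / KL(μ_min, (μ_max + 1) / 2)`. When the divergence is infinite (that is, when
`μ_max = 1` and `μ_min < 1`), `toReal` sends it to `0`, and division by `0` gives the intended value
`Δ / ∞ = 0`. -/
def Instance.D {U K : ℕ} (I : Instance U K) : ℝ :=
  I.gap / (bernKL I.muMin ((I.muMax + 1) / 2)).toReal

/-- Everything that happens in one time slot: the arrivals, the scheduled matching of queues and
servers, and the services that each server offers to each queue. -/
structure Slot (U K : ℕ) where
  arrival : Fin U → Bool
  matching : Fin U ≃. Fin K
  service : Fin U × Fin K → Bool

/-- What the scheduler observes in one time slot: the arrivals, the scheduled matching, and for each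
queue the service offered by the server that is assigned to it. -/
structure Obs (U K : ℕ) where
  arrival : Fin U → Bool
  matching : Fin U ≃. Fin K
  offered : Fin U → Bool

/-- The service offered to queue `u` by the server assigned to it (none if no server is). -/
def Slot.offered {U K : ℕ} (s : Slot U K) (u : Fin U) : Bool :=
  match s.matching u with
  | some k => s.service (u, k)
  | none => false

def Slot.obs {U K : ℕ} (s : Slot U K) : Obs U K := ⟨s.arrival, s.matching, s.offered⟩

/-- A (randomized) scheduling policy: the law of the matching in the next time slot, given the past
observations. All histories are lists with the most recent time slot first, so that the time is the
length of the list plus one. The policy does not know the instance. -/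
abbrev Policy (U K : ℕ) := List (Obs U K) → PMF (Fin U ≃. Fin K)

/-- The law of the first `t` time slots. In each slot the matching is drawn by the policy from the
past observations; the arrivals and the offered services are independent Bernoulli variables,
independent of the past and of the matching. -/
def trajLaw {U K : ℕ} (I : Instance U K) (pol : Policy U K) : ℕ → PMF (List (Slot U K))
  | 0 => PMF.pure []
  | t + 1 =>
    (trajLaw I pol t).bind fun h =>
      (pol (h.map Slot.obs)).bind fun m =>
        (coins I.lam).bind fun a =>
          (coins fun p : Fin U × Fin K => I.mu p.1 p.2).map fun r => ⟨a, m, r⟩ :: h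

/-- The number of time slots in which server `k` is assigned to queue `u`. -/
def plays {U K : ℕ} (u : Fin U) (k : Fin K) (h : List (Slot U K)) : ℕ :=
  h.countP fun s => s.matching u = some k

/-- A policy is `α`-consistent if, on every problem instance, the expected number of times that
a server is assigned in the first `t` slots to a queue for which it is not the best server
is `O(t ^ α)`. -/
def IsConsistent {U K : ℕ} (pol : Policy U K) (α : ℝ) : Prop :=
  ∀ (I : Instance U K) (u : Fin U) (k : Fin K), k ≠ I.best u →
    (fun t : ℕ => expect (trajLaw I pol t) fun h => (plays u k h : ℝ))
      =O[atTop] fun t : ℕ => (t : ℝ) ^ α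

/-- The length of queue `u` from the initial length `q`: `Q(t) = (Q(t-1) + A(t) - S(t))⁺`
(the subtraction of natural numbers is truncated at zero). -/
def queue {U K : ℕ} (u : Fin U) (q : ℕ) : List (Slot U K) → ℕ
  | [] => q
  | s :: h => queue u q h + (s.arrival u).toNat - (s.offered u).toNat

/-- The length of queue `u` when it is always served by its best server. -/
def optQueue {U K : ℕ} (I : Instance U K) (u : Fin U) (q : ℕ) : List (Slot U K) → ℕ
  | [] => q
  | s :: h => optQueue I u q h + (s.arrival u).toNat - (s.service (u, I.best u)).toNat

/-- `π` is a stationary law of the queue with arrival rate `lam` and service rate `mu`. -/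
def IsStationary (lam mu : unitInterval) (π : PMF ℕ) : Prop :=
  (π.bind fun q => (coin lam).bind fun a => (coin mu).map fun s => q + a.toNat - s.toNat) = π

/-- The queue-regret `E[Q_u(t) - Q*_u(t)]`, both systems starting from the same initial length
of law `π`, which is independent of the arrivals, services and decisions. -/
def regret {U K : ℕ} (I : Instance U K) (pol : Policy U K) (π : PMF ℕ) (u : Fin U) (t : ℕ) : ℝ :=
  expect (π.bind fun q => (trajLaw I pol t).map fun h => (q, h)) fun x =>
    (queue u x.1 x.2 : ℝ) - (optQueue I u x.1 x.2 : ℝ)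

end QueueingBandit

end

open QueueingBandit

/-!
The regret of a queue in one slot is at least the service rate lost in that slot, and a policy that
is consistent on all instances must lose service in order to tell instances apart.

*Regret in one slot* (`le_regret`). Let `queueStep` be the transition operator of a queue on functions
of its length. It maps monotone functions to monotone functions and decreases when the service
rate grows, so under every policy the law of the queue dominates that of the optimally
served queue (`le_expect_queue`), whatever the initial length. No coupling of the two systems is
needed: only the two means enter. In the last slot, a lost service rate `δ` moreover adds at least
`λ δ` to the mean, since a service is never wasted in a slot with an arrival. As a miss (a
slot in which the queue does not get its best server) loses at least the gap `Δ`, the regret at time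
`t + 1` is at least `λ Δ` times the probability of a miss in slot `t + 1`. Stationarity of the
initial law plays no role.

*Misses are at least logarithmic* (`mul_log_le_misses`). If the misses of a queue `u` had a mean of
order less than `t`, then `u` would get its best server in most slots. Under an alternative instance
with another best server for `u`, consistency makes this event improbable, of order `t ^ (α - 1)`. By
a change of measure on the observations (`half_mul_exp_le_expect`) the divergence between the two
laws of the observations is therefore at least of order `(1 - α) log t`; and it is the sum, over
the pairs whose service rate differs, of the mean number of assignments times the divergence of the
two service laws (`expect_llr`). There are two kinds of alternatives, with raised rates
`(μ_max + 1) / 2`: either `u` prefers one of the `K - U` servers that are nobody's best, or `u` and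
another queue exchange their best servers. All the assignments that are counted cost `u` a miss, and
summing over the alternatives bounds the mean number of misses below by `tests U K` times a multiple
of `log t`.

*Conclusion* (`frequently_le_sum_missProb`, `frequently_le_sum_regret`). If the probability of a miss
were eventually below a small multiple of `1 / t`, its partial sums would contradict the logarithmic
bound. This also supplies the assumption that misses are rare, which consistency alone does not: a
consistent policy may leave queues unserved.
-/

noncomputable section

namespace QueueingBandit

/-! ### Expectations under discrete laws -/

section Expect

variable {Ω Ω' : Type}

lemma summable_toReal (p : PMF Ω) : Summable fun x => (p x).toReal :=
  ENNReal.summable_toReal p.tsum_coe_ne_top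

lemma tsum_toReal (p : PMF Ω) : ∑' x, (p x).toReal = 1 := by
  rw [← ENNReal.tsum_toReal_eq fun x => p.apply_ne_top x, p.tsum_coe, ENNReal.toReal_one]

lemma summable_of_bound (p : PMF Ω) (f : Ω → ℝ) (C : ℝ) (hf : ∀ x ∈ p.support, |f x| ≤ C) :
    Summable fun x => (p x).toReal * f x := by
  refine Summable.of_norm_bounded ((summable_toReal p).mul_right C) fun x => ?_
  rw [Real.norm_eq_abs, abs_mul, abs_of_nonneg ENNReal.toReal_nonneg]
  by_cases hx : x ∈ p.support
  · exact mul_le_mul_of_nonneg_left (hf x hx) ENNReal.toReal_nonneg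
  · rw [PMF.mem_support_iff, not_not] at hx
    simp [hx]

lemma summable_of_finite {p : PMF Ω} (hp : p.support.Finite) (f : Ω → ℝ) :
    Summable fun x => (p x).toReal * f x := by
  refine summable_of_hasFiniteSupport (hp.subset fun x hx => ?_)
  rw [PMF.mem_support_iff]
  intro h
  simp [h] at hx

lemma expect_const (p : PMF Ω) (c : ℝ) : expect p (fun _ => c) = c := by
  rw [expect, tsum_mul_right, tsum_toReal, one_mul]

lemma expect_const_mul (p : PMF Ω) (c : ℝ) (f : Ω → ℝ) :
    expect p (fun x => c * f x) = c * expect p f := by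
  simp only [expect, ← tsum_mul_left]
  exact tsum_congr fun x => by ring

lemma expect_congr {p : PMF Ω} {f g : Ω → ℝ} (h : ∀ x ∈ p.support, f x = g x) :
    expect p f = expect p g := by
  refine tsum_congr fun x => ?_
  by_cases hx : x ∈ p.support
  · rw [h x hx]
  · rw [PMF.mem_support_iff, not_not] at hx
    simp [hx]

lemma expect_nonneg {p : PMF Ω} {f : Ω → ℝ} (h : ∀ x, 0 ≤ f x) : 0 ≤ expect p f :=
  tsum_nonneg fun x => mul_nonneg ENNReal.toReal_nonneg (h x)

lemma expect_mono_of_summable {p : PMF Ω} {f g : Ω → ℝ}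
    (hf : Summable fun x => (p x).toReal * f x) (hg : Summable fun x => (p x).toReal * g x)
    (h : ∀ x ∈ p.support, f x ≤ g x) : expect p f ≤ expect p g := by
  refine hf.tsum_le_tsum (fun x => ?_) hg
  by_cases hx : x ∈ p.support
  · exact mul_le_mul_of_nonneg_left (h x hx) ENNReal.toReal_nonneg
  · rw [PMF.mem_support_iff, not_not] at hx
    simp [hx]

lemma expect_mono {p : PMF Ω} (hp : p.support.Finite) {f g : Ω → ℝ}
    (h : ∀ x ∈ p.support, f x ≤ g x) : expect p f ≤ expect p g :=
  expect_mono_of_summable (summable_of_finite hp f) (summable_of_finite hp g) h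

lemma expect_add {p : PMF Ω} (hp : p.support.Finite) (f g : Ω → ℝ) :
    expect p (fun x => f x + g x) = expect p f + expect p g := by
  simp only [expect, mul_add]
  exact (summable_of_finite hp f).tsum_add (summable_of_finite hp g)

lemma expect_sub {p : PMF Ω} (hp : p.support.Finite) (f g : Ω → ℝ) :
    expect p (fun x => f x - g x) = expect p f - expect p g := by
  simp only [expect, mul_sub]
  exact (summable_of_finite hp f).tsum_sub (summable_of_finite hp g)

lemma expect_sum {p : PMF Ω} (hp : p.support.Finite) {ι : Type} (s : Finset ι) (f : ι → Ω → ℝ) :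
    expect p (fun x => ∑ i ∈ s, f i x) = ∑ i ∈ s, expect p (f i) := by
  simp only [expect, Finset.mul_sum]
  exact Summable.tsum_finsetSum fun i _ => summable_of_finite hp (f i)

lemma expect_pure (x : Ω) (f : Ω → ℝ) : expect (PMF.pure x) f = f x := by
  classical
  rw [expect, tsum_eq_single x]
  · simp
  · intro y hy
    simp [PMF.pure_apply, hy]

lemma expect_fintype [Fintype Ω] (p : PMF Ω) (f : Ω → ℝ) :
    expect p f = ∑ x, (p x).toReal * f x :=
  tsum_fintype _

/-- The tower property, for functions that are bounded on the support. -/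
lemma expect_bind_of_bound (p : PMF Ω) (k : Ω → PMF Ω') (f : Ω' → ℝ) (C : ℝ)
    (hf : ∀ y ∈ (p.bind k).support, |f y| ≤ C) :
    expect (p.bind k) f = expect p fun x => expect (k x) f := by
  have hk : ∀ y, ((p.bind k) y).toReal = ∑' x, (p x).toReal * (k x y).toReal := by
    intro y
    rw [PMF.bind_apply, ENNReal.tsum_toReal_eq fun x =>
      ENNReal.mul_ne_top (p.apply_ne_top x) ((k x).apply_ne_top y)]
    simp [ENNReal.toReal_mul]
  have hs : Summable fun z : Ω × Ω' => (p z.1).toReal * (k z.1 z.2).toReal := by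
    have h0 : 0 ≤ fun z : Ω × Ω' => (p z.1).toReal * (k z.1 z.2).toReal := fun z =>
      mul_nonneg ENNReal.toReal_nonneg ENNReal.toReal_nonneg
    have h1 : ∀ x, Summable fun y => (p x).toReal * (k x y).toReal := fun x =>
      Summable.mul_left _ (summable_toReal (k x))
    have h2 : Summable fun x => ∑' y, (p x).toReal * (k x y).toReal := by
      simp only [tsum_mul_left, tsum_toReal, mul_one]
      exact summable_toReal p
    exact (summable_prod_of_nonneg h0).2 ⟨h1, h2⟩
  have hs' : Summable fun z : Ω × Ω' => (p z.1).toReal * (k z.1 z.2).toReal * f z.2 := by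
    refine Summable.of_norm_bounded (hs.mul_right C) fun z => ?_
    have h0 : 0 ≤ (p z.1).toReal * (k z.1 z.2).toReal :=
      mul_nonneg ENNReal.toReal_nonneg ENNReal.toReal_nonneg
    rw [Real.norm_eq_abs, abs_mul, abs_of_nonneg h0]
    by_cases hz : z.2 ∈ (p.bind k).support
    · exact mul_le_mul_of_nonneg_left (hf _ hz) h0
    · have : (p z.1).toReal * (k z.1 z.2).toReal = 0 := by
        rw [PMF.mem_support_bind_iff] at hz
        push Not at hz
        by_cases h1 : z.1 ∈ p.support
        · have := hz _ h1
          rw [PMF.mem_support_iff, not_not] at this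
          simp [this]
        · rw [PMF.mem_support_iff, not_not] at h1
          simp [h1]
      simp [this]
  calc expect (p.bind k) f
      = ∑' y, ∑' x, (p x).toReal * (k x y).toReal * f y :=
        tsum_congr fun y => by rw [hk, tsum_mul_right]
    _ = ∑' x, ∑' y, (p x).toReal * (k x y).toReal * f y :=
        (Summable.tsum_comm (f := fun x y => (p x).toReal * (k x y).toReal * f y) hs')
    _ = expect p fun x => expect (k x) f := by
        refine tsum_congr fun x => ?_
        simp only [expect, ← tsum_mul_left]
        exact tsum_congr fun y => by ring

lemma expect_bind {p : PMF Ω} {k : Ω → PMF Ω'} (h : (p.bind k).support.Finite) (f : Ω' → ℝ) :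
    expect (p.bind k) f = expect p fun x => expect (k x) f := by
  obtain ⟨C, hC⟩ := (h.image fun y => |f y|).bddAbove
  exact expect_bind_of_bound p k f C fun y hy => hC ⟨y, hy, rfl⟩

lemma expect_map (p : PMF Ω) (e : Ω → Ω') (he : Function.Injective e) (f : Ω' → ℝ) :
    expect (p.map e) f = expect p fun x => f (e x) := by
  classical
  unfold expect
  rw [← he.tsum_eq]
  · refine tsum_congr fun x => ?_
    congr 2
    rw [PMF.map_apply, tsum_eq_single x]
    · simp
    · intro y hy
      rw [if_neg fun h => hy (he h).symm]
  · intro y hy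
    by_contra hne
    refine hy ?_
    have : (p.map e) y = 0 := by
      rw [PMF.apply_eq_zero_iff, PMF.mem_support_map_iff]
      rintro ⟨x, -, rfl⟩
      exact hne ⟨x, rfl⟩
    simp [this]

end Expect

/-! ### Bernoulli laws -/

section Coins

/-- The mass that the Bernoulli law of mean `p` gives to `b`, as a real number. -/
def mass (p : unitInterval) (b : Bool) : ℝ := if b then (p : ℝ) else 1 - p

@[simp] lemma mass_true (p : unitInterval) : mass p true = p := rfl

@[simp] lemma mass_false (p : unitInterval) : mass p false = 1 - p := rfl

lemma mass_nonneg (p : unitInterval) (b : Bool) : 0 ≤ mass p b := by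
  cases b
  · exact sub_nonneg.2 p.2.2
  · exact p.2.1

lemma coin_toReal (p : unitInterval) (b : Bool) : (coin p b).toReal = mass p b := by
  cases b
  · simpa [coin] using ENNReal.toReal_ofReal (sub_nonneg.2 p.2.2)
  · simpa [coin] using ENNReal.toReal_ofReal p.2.1

lemma expect_coin (p : unitInterval) (f : Bool → ℝ) :
    expect (coin p) f = p * f true + (1 - p) * f false := by
  rw [expect_fintype, Fintype.sum_bool, coin_toReal, coin_toReal, mass_true, mass_false]

variable {ι : Type} [Fintype ι] [DecidableEq ι]

lemma expect_coins (p : ι → unitInterval) (f : (ι → Bool) → ℝ) :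
    expect (coins p) f = ∑ x, (∏ i, mass (p i) (x i)) * f x := by
  rw [expect_fintype]
  refine Finset.sum_congr rfl fun x _ => ?_
  simp [coins, ENNReal.toReal_prod, coin_toReal]

lemma expect_coins_prod (p : ι → unitInterval) (φ : ι → Bool → ℝ) :
    expect (coins p) (fun x => ∏ i, φ i (x i)) = ∏ i, expect (coin (p i)) (φ i) := by
  rw [expect_coins]
  simp only [← Finset.prod_mul_distrib, expect_fintype, coin_toReal]
  exact (Fintype.prod_sum fun i b => mass (p i) b * φ i b).symm

lemma expect_coins_apply (p : ι → unitInterval) (i : ι) (f : Bool → ℝ) :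
    expect (coins p) (fun x => f (x i)) = expect (coin (p i)) f := by
  have h := expect_coins_prod p fun j b => if j = i then f b else 1
  simp only [Finset.prod_ite_eq', Finset.mem_univ, if_true] at h
  rw [h, Finset.prod_eq_single i]
  · simp
  · intro j _ hj
    simp [hj, expect_const]
  · simp

/-- The expectation of a function of the coordinates in `S` depends only on the means in `S`. -/
lemma expect_coins_congr (S : ι → Prop) {p p' : ι → unitInterval} (hp : ∀ i, S i → p i = p' i)
    {f : (ι → Bool) → ℝ} (hf : ∀ x y, (∀ i, S i → x i = y i) → f x = f y) :
    expect (coins p) f = expect (coins p') f := by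
  classical
  -- `f x` is the sum over `s` of `f s` times the indicator that `s` agrees with `x` on `S` and is
  -- `true` off `S`; each indicator is a product over the coordinates.
  let φ : (ι → Bool) → ι → Bool → ℝ := fun s i b =>
    if S i then (if b = s i then 1 else 0) else (if s i = true then 1 else 0)
  have key : f = fun x => ∑ s, f s * ∏ i, φ s i (x i) := by
    funext x
    let s₀ : ι → Bool := fun i => if S i then x i else true
    rw [Finset.sum_eq_single s₀]
    · have h1 : ∏ i, φ s₀ i (x i) = 1 := by
        refine Finset.prod_eq_one fun i _ => ?_
        by_cases hi : S i <;> simp [φ, s₀, hi]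
      rw [h1, mul_one]
      exact hf _ _ fun i hi => by simp [s₀, hi]
    · intro s _ hs
      obtain ⟨i, hi⟩ := Function.ne_iff.1 hs
      rw [Finset.prod_eq_zero (Finset.mem_univ i), mul_zero]
      by_cases hS : S i
      · simp only [s₀, hS, if_true] at hi
        simp [φ, hS, Ne.symm hi]
      · simp only [s₀, hS, if_false] at hi
        simp [φ, hS, hi]
    · simp
  have e : ∀ p : ι → unitInterval,
      expect (coins p) f = ∑ s, f s * ∏ i, expect (coin (p i)) (φ s i) := by
    intro p
    conv_lhs => rw [key]
    rw [expect_sum (Set.toFinite _)]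
    refine Finset.sum_congr rfl fun s _ => ?_
    rw [expect_const_mul, expect_coins_prod]
  rw [e, e]
  refine Finset.sum_congr rfl fun s _ => ?_
  congr 1
  refine Finset.prod_congr rfl fun i _ => ?_
  by_cases hi : S i
  · rw [hp i hi]
  · simp only [φ, hi, if_false, expect_const]

end Coins

/-! ### The law of the trajectory -/

section Trajectory

variable {U K : ℕ}

instance : Finite (Fin U ≃. Fin K) :=
  Finite.of_injective (fun m : Fin U ≃. Fin K => (m : Fin U → Option (Fin K)))
    DFunLike.coe_injective

instance : Finite (Slot U K) :=
  Finite.of_injective (fun s : Slot U K => (s.arrival, s.matching, s.service)) fun s s' h => by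
    cases s; cases s'; simpa using h

lemma length_of_mem_support_trajLaw (I : Instance U K) (pol : Policy U K) (t : ℕ) :
    ∀ h ∈ (trajLaw I pol t).support, h.length = t := by
  induction t with
  | zero => simp [trajLaw]
  | succ t ih =>
    intro h hh
    simp only [trajLaw, PMF.mem_support_bind_iff, PMF.mem_support_map_iff] at hh
    obtain ⟨h', hh', m, -, a, -, r, -, rfl⟩ := hh
    simp [ih h' hh']

lemma finite_support_trajLaw (I : Instance U K) (pol : Policy U K) (t : ℕ) :
    (trajLaw I pol t).support.Finite :=
  (List.finite_length_eq (Slot U K) t).subset (length_of_mem_support_trajLaw I pol t)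

/-- The expectation, over the arrivals and services of one slot with matching `m`. -/
def slotMean (I : Instance U K) (m : Fin U ≃. Fin K) (f : Slot U K → ℝ) : ℝ :=
  expect (coins I.lam) fun a => expect (coins fun p : Fin U × Fin K => I.mu p.1 p.2) fun r =>
    f ⟨a, m, r⟩

/-- One-step conditioning. -/
lemma expect_trajLaw_succ (I : Instance U K) (pol : Policy U K) (t : ℕ)
    (f : List (Slot U K) → ℝ) :
    expect (trajLaw I pol (t + 1)) f = expect (trajLaw I pol t) fun h =>
      expect (pol (h.map Slot.obs)) fun m => slotMean I m fun s => f (s :: h) := by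
  have hfin := finite_support_trajLaw I pol (t + 1)
  rw [trajLaw] at hfin ⊢
  rw [expect_bind hfin]
  refine expect_congr fun h hh => ?_
  have sub : ∀ {Ω Ω' : Type} {p : PMF Ω} {k : Ω → PMF Ω'} {x : Ω}, x ∈ p.support →
      (p.bind k).support.Finite → (k x).support.Finite := by
    intro Ω Ω' p k x hx hfin
    exact hfin.subset fun y hy => (PMF.mem_support_bind_iff _ _ _).2 ⟨x, hx, hy⟩
  have h1 := sub hh hfin
  rw [expect_bind h1]
  refine expect_congr fun m hm => ?_
  have h2 := sub hm h1
  rw [expect_bind h2, slotMean]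
  refine expect_congr fun a _ => ?_
  rw [expect_map]
  intro r r' hr
  simpa using hr

lemma slotMean_const (I : Instance U K) (m : Fin U ≃. Fin K) (c : ℝ) :
    slotMean I m (fun _ => c) = c := by
  simp [slotMean, expect_const]

lemma slotMean_add (I : Instance U K) (m : Fin U ≃. Fin K) (f g : Slot U K → ℝ) :
    slotMean I m (fun s => f s + g s) = slotMean I m f + slotMean I m g := by
  simp only [slotMean, expect_add (Set.toFinite _)]

lemma slotMean_const_mul (I : Instance U K) (m : Fin U ≃. Fin K) (c : ℝ) (f : Slot U K → ℝ) :
    slotMean I m (fun s => c * f s) = c * slotMean I m f := by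
  simp only [slotMean, expect_const_mul]

lemma slotMean_sum (I : Instance U K) (m : Fin U ≃. Fin K) {ι : Type} (A : Finset ι)
    (f : ι → Slot U K → ℝ) :
    slotMean I m (fun s => ∑ i ∈ A, f i s) = ∑ i ∈ A, slotMean I m (f i) := by
  simp only [slotMean, expect_sum (Set.toFinite _)]

lemma slotMean_of_matching (I : Instance U K) (m : Fin U ≃. Fin K)
    (f : (Fin U ≃. Fin K) → ℝ) : slotMean I m (fun s => f s.matching) = f m := by
  simp [slotMean, expect_const]

lemma slotMean_service (I : Instance U K) (m : Fin U ≃. Fin K) (p : Fin U × Fin K)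
    (f : Bool → ℝ) :
    slotMean I m (fun s => f (s.service p)) = expect (coin (I.mu p.1 p.2)) f := by
  have h := expect_coins_apply (fun p : Fin U × Fin K => I.mu p.1 p.2) p f
  simp only [slotMean, h, expect_const]

lemma expect_additive_succ (I : Instance U K) (pol : Policy U K) (t : ℕ) (φ : Slot U K → ℝ) :
    expect (trajLaw I pol (t + 1)) (fun h => (h.map φ).sum) =
      expect (trajLaw I pol t) (fun h => expect (pol (h.map Slot.obs)) fun m => slotMean I m φ) +
        expect (trajLaw I pol t) (fun h => (h.map φ).sum) := by
  rw [expect_trajLaw_succ, ← expect_add (finite_support_trajLaw I pol t)]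
  refine expect_congr fun h _ => ?_
  simp only [List.map_cons, List.sum_cons]
  rw [← expect_const (pol (h.map Slot.obs)) (h.map φ).sum, ← expect_add (Set.toFinite _)]
  refine expect_congr fun m _ => ?_
  rw [expect_const, slotMean_add, slotMean_const]

lemma expect_additive_congr (I : Instance U K) (pol : Policy U K) {φ ψ : Slot U K → ℝ}
    (h : ∀ m, slotMean I m φ = slotMean I m ψ) (t : ℕ) :
    expect (trajLaw I pol t) (fun h => (h.map φ).sum) =
      expect (trajLaw I pol t) (fun h => (h.map ψ).sum) := by
  induction t with
  | zero => simp [trajLaw, expect_pure]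
  | succ t ih => simp only [expect_additive_succ, ih, h]

end Trajectory

/-! ### Regret in one time slot -/

section Queue

/-- The transition operator of a queue with arrival rate `l` and service rate `m`. -/
def queueStep (l m : unitInterval) (F : ℕ → ℝ) (q : ℕ) : ℝ :=
  expect (coin l) fun a => expect (coin m) fun s => F (q + a.toNat - s.toNat)

lemma queueStep_eq (l m : unitInterval) (F : ℕ → ℝ) (q : ℕ) :
    queueStep l m F q = l * (F (q + 1) - m * (F (q + 1) - F q)) +
      (1 - l) * (F q - m * (F q - F (q - 1))) := by
  simp only [queueStep, expect_coin, Bool.toNat_true, Bool.toNat_false, Nat.sub_zero,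
    Nat.add_zero, Nat.add_sub_cancel]
  ring

lemma queueStep_mono (l m : unitInterval) {F : ℕ → ℝ} (hF : Monotone F) :
    Monotone (queueStep l m F) := fun q q' h =>
  expect_mono (Set.toFinite _) fun a _ => expect_mono (Set.toFinite _) fun s _ => hF (by omega)

lemma queueStep_anti_rate (l : unitInterval) {m m' : unitInterval} (h : m ≤ m') {F : ℕ → ℝ}
    (hF : Monotone F) (q : ℕ) : queueStep l m' F q ≤ queueStep l m F q := by
  rw [queueStep_eq, queueStep_eq]
  have hl := l.2.1
  have hl' := sub_nonneg.2 l.2.2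
  have h' : (m : ℝ) ≤ m' := h
  have h1 := sub_nonneg.2 (hF q.le_succ)
  have h2 := sub_nonneg.2 (hF q.pred_le)
  have h3 := mul_le_mul_of_nonneg_right h' h1
  have h4 := mul_le_mul_of_nonneg_right h' h2
  exact add_le_add (mul_le_mul_of_nonneg_left (sub_le_sub_left h3 _) hl)
    (mul_le_mul_of_nonneg_left (sub_le_sub_left h4 _) hl')

/-- A loss of service rate shows at once in the mean length whenever there is an arrival. -/
lemma queueStep_cast_gain (l m m' : unitInterval) (h : m ≤ m') (q : ℕ) :
    queueStep l m' (fun n => (n : ℝ)) q + l * ((m' : ℝ) - m) ≤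
      queueStep l m (fun n => (n : ℝ)) q := by
  rw [queueStep_eq, queueStep_eq]
  have h' : (m : ℝ) ≤ m' := h
  have hq : ((q - 1 : ℕ) : ℝ) ≤ q := Nat.cast_le.2 (Nat.sub_le _ _)
  have h4 := mul_nonneg (sub_nonneg.2 l.2.2)
    (mul_nonneg (sub_nonneg.2 h') (sub_nonneg.2 hq))
  push_cast
  linarith

variable {U K : ℕ}

/-- The service rate that queue `u` receives under the matching `m`. -/
def rate (I : Instance U K) (u : Fin U) (m : Fin U ≃. Fin K) : unitInterval :=
  match m u with
  | some k => I.mu u k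
  | none => 0

lemma slotMean_queue (I : Instance U K) (u : Fin U) (m : Fin U ≃. Fin K) (F : ℕ → ℝ) (q : ℕ) :
    slotMean I m (fun s => F (q + (s.arrival u).toNat - (s.offered u).toNat)) =
      queueStep (I.lam u) (rate I u m) F q := by
  unfold slotMean Slot.offered rate
  cases hm : m u with
  | none =>
    simp only [hm, expect_const]
    rw [expect_coins_apply I.lam u fun b => F (q + b.toNat - Bool.toNat false)]
    simp [queueStep, expect_coin]
  | some k =>
    simp only [hm]
    have h := fun a : Fin U → Bool =>
      expect_coins_apply (fun p : Fin U × Fin K => I.mu p.1 p.2) (u, k)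
        fun b => F (q + (a u).toNat - b.toNat)
    simp only [h]
    exact expect_coins_apply I.lam u fun b =>
      expect (coin (I.mu u k)) fun s => F (q + b.toNat - s.toNat)

lemma slotMean_optQueue (I : Instance U K) (u : Fin U) (m : Fin U ≃. Fin K) (F : ℕ → ℝ) (q : ℕ) :
    slotMean I m (fun s => F (q + (s.arrival u).toNat - (s.service (u, I.best u)).toNat)) =
      queueStep (I.lam u) (I.mu u (I.best u)) F q := by
  unfold slotMean
  have h := fun a : Fin U → Bool =>
    expect_coins_apply (fun p : Fin U × Fin K => I.mu p.1 p.2) (u, I.best u)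
      fun b => F (q + (a u).toNat - b.toNat)
  simp only [h]
  exact expect_coins_apply I.lam u fun b =>
    expect (coin (I.mu u (I.best u))) fun s => F (q + b.toNat - s.toNat)

lemma rate_le (I : Instance U K) (u : Fin U) (m : Fin U ≃. Fin K) :
    rate I u m ≤ I.mu u (I.best u) := by
  unfold rate
  cases m u with
  | none => exact (I.mu u (I.best u)).2.1
  | some k =>
    by_cases hk : k = I.best u
    · simp [hk]
    · exact (I.mu_lt_best u k hk).le

/-- The indicator that the matching `m` does not assign its best server to queue `u`. -/
def miss (I : Instance U K) (u : Fin U) (m : Fin U ≃. Fin K) : ℝ :=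
  if m u = some (I.best u) then 0 else 1

lemma miss_nonneg (I : Instance U K) (u : Fin U) (m : Fin U ≃. Fin K) : 0 ≤ miss I u m := by
  unfold miss; split_ifs <;> norm_num

lemma gap_le (I : Instance U K) (u : Fin U) (k : Fin K) (hk : k ≠ I.best u) :
    I.gap ≤ I.mu u (I.best u) - I.mu u k :=
  ciInf_le (Set.finite_range _).bddBelow
    (⟨(u, k), hk⟩ : {p : Fin U × Fin K // p.2 ≠ I.best p.1})

lemma gap_nonneg (I : Instance U K) : 0 ≤ I.gap :=
  Real.iInf_nonneg fun p => sub_nonneg.2 (I.mu_lt_best p.1.1 p.1.2 p.2).le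

lemma gap_mul_miss_le (I : Instance U K) (u : Fin U) (m : Fin U ≃. Fin K) :
    I.gap * miss I u m ≤ I.mu u (I.best u) - rate I u m := by
  unfold miss
  split_ifs with h
  · rw [mul_zero]
    exact sub_nonneg.2 (rate_le I u m)
  · rw [mul_one]
    have h0 : ((0 : unitInterval) : ℝ) = 0 := rfl
    unfold rate
    cases hm : m u with
    | some k =>
      refine gap_le I u k ?_
      rintro rfl
      exact h hm
    | none =>
      simp only [h0, sub_zero]
      by_cases hk : ∃ k, k ≠ I.best u
      · obtain ⟨k, hk⟩ := hk
        have := (I.mu u k).2.1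
        linarith [gap_le I u k hk]
      · -- with a single server the gap is an infimum over the empty set, hence zero
        push Not at hk
        have : IsEmpty {p : Fin U × Fin K // p.2 ≠ I.best p.1} :=
          ⟨fun p => p.2 ((hk _).trans (hk _).symm)⟩
        rw [Instance.gap, Real.iInf_of_isEmpty]
        exact (I.mu u (I.best u)).2.1

/-- The probability that queue `u` does not get its best server in slot `t + 1`. -/
def missProb (I : Instance U K) (pol : Policy U K) (u : Fin U) (t : ℕ) : ℝ :=
  expect (trajLaw I pol t) fun h => expect (pol (h.map Slot.obs)) (miss I u)

lemma missProb_nonneg (I : Instance U K) (pol : Policy U K) (u : Fin U) (t : ℕ) :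
    0 ≤ missProb I pol u t :=
  expect_nonneg fun _ => expect_nonneg fun _ => miss_nonneg I u _

lemma expect_optQueue (I : Instance U K) (pol : Policy U K) (u : Fin U) (q t : ℕ) (F : ℕ → ℝ) :
    expect (trajLaw I pol t) (fun h => F (optQueue I u q h)) =
      (queueStep (I.lam u) (I.mu u (I.best u)))^[t] F q := by
  induction t generalizing F with
  | zero => simp [trajLaw, expect_pure, optQueue]
  | succ t ih =>
    rw [expect_trajLaw_succ, Function.iterate_succ_apply, ← ih]
    refine expect_congr fun h _ => ?_
    simp only [optQueue, slotMean_optQueue, expect_const]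

/-- The queue under any policy stochastically dominates the queue under the optimal matching. -/
lemma le_expect_queue (I : Instance U K) (pol : Policy U K) (u : Fin U) (q t : ℕ) {F : ℕ → ℝ}
    (hF : Monotone F) :
    (queueStep (I.lam u) (I.mu u (I.best u)))^[t] F q ≤
      expect (trajLaw I pol t) (fun h => F (queue u q h)) := by
  induction t generalizing F with
  | zero => simp [trajLaw, expect_pure, queue]
  | succ t ih =>
    rw [expect_trajLaw_succ, Function.iterate_succ_apply]
    refine (ih (queueStep_mono _ _ hF)).trans
      (expect_mono (finite_support_trajLaw I pol t) fun h _ => ?_)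
    simp only [queue, slotMean_queue]
    rw [← expect_const (pol (h.map Slot.obs)) (queueStep _ _ F _)]
    exact expect_mono (Set.toFinite _) fun m _ => queueStep_anti_rate _ (rate_le I u m) hF _

lemma le_expect_queue_sub_optQueue (I : Instance U K) (pol : Policy U K) (u : Fin U) (q t : ℕ) :
    I.lam u * I.gap * missProb I pol u t ≤ expect (trajLaw I pol (t + 1)) fun h =>
      (queue u q h : ℝ) - (optQueue I u q h : ℝ) := by
  have hmono : Monotone fun n : ℕ => (n : ℝ) := Nat.mono_cast
  rw [expect_sub (finite_support_trajLaw I pol (t + 1)),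
    expect_optQueue I pol u q (t + 1) fun n => (n : ℝ), Function.iterate_succ_apply]
  have h1 := le_expect_queue I pol u q t
    (queueStep_mono (I.lam u) (I.mu u (I.best u)) hmono)
  have h2 : expect (trajLaw I pol t) (fun h =>
        queueStep (I.lam u) (I.mu u (I.best u)) (fun n => (n : ℝ)) (queue u q h)) +
      I.lam u * I.gap * missProb I pol u t ≤
      expect (trajLaw I pol (t + 1)) fun h => (queue u q h : ℝ) := by
    rw [missProb, ← expect_const_mul, ← expect_add (finite_support_trajLaw I pol t),
      expect_trajLaw_succ]
    refine expect_mono (finite_support_trajLaw I pol t) fun h _ => ?_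
    simp only [queue]
    rw [← expect_const_mul, ← expect_const (pol (h.map Slot.obs)) (queueStep _ _ _ _),
      ← expect_add (Set.toFinite _)]
    refine expect_mono (Set.toFinite _) fun m _ => ?_
    rw [slotMean_queue I u m (fun n => (n : ℝ))]
    refine le_trans ?_ (queueStep_cast_gain _ _ _ (rate_le I u m) _)
    rw [mul_assoc]
    exact add_le_add le_rfl (mul_le_mul_of_nonneg_left (gap_mul_miss_le I u m) (I.lam u).2.1)
  linarith

lemma queue_bounds (u : Fin U) (q : ℕ) (h : List (Slot U K)) :
    queue u q h ≤ q + h.length ∧ q ≤ queue u q h + h.length := by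
  induction h with
  | nil => simp [queue]
  | cons s h ih =>
    have h1 := Bool.toNat_le (s.arrival u)
    have h2 := Bool.toNat_le (s.offered u)
    simp only [queue, List.length_cons]
    omega

lemma optQueue_bounds (I : Instance U K) (u : Fin U) (q : ℕ) (h : List (Slot U K)) :
    optQueue I u q h ≤ q + h.length ∧ q ≤ optQueue I u q h + h.length := by
  induction h with
  | nil => simp [optQueue]
  | cons s h ih =>
    have h1 := Bool.toNat_le (s.arrival u)
    have h2 := Bool.toNat_le (s.service (u, I.best u))
    simp only [optQueue, List.length_cons]
    omega

lemma abs_queue_sub_optQueue_le (I : Instance U K) (u : Fin U) (q : ℕ) (h : List (Slot U K)) :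
    |(queue u q h : ℝ) - (optQueue I u q h : ℝ)| ≤ 2 * h.length := by
  obtain ⟨h1, h2⟩ := queue_bounds u q h
  obtain ⟨h3, h4⟩ := optQueue_bounds I u q h
  rify at h1 h2 h3 h4
  rw [abs_le]
  constructor <;> linarith

/-- The regret is at least the loss in the last slot, whatever the initial law. -/
lemma le_regret (I : Instance U K) (pol : Policy U K) (π : PMF ℕ) (u : Fin U) (t : ℕ) :
    I.lam u * I.gap * missProb I pol u t ≤ regret I pol π u (t + 1) := by
  have hC : ∀ q, ∀ h ∈ (trajLaw I pol (t + 1)).support,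
      |(queue u q h : ℝ) - (optQueue I u q h : ℝ)| ≤ 2 * (t + 1 : ℕ) := fun q h hh => by
    have := abs_queue_sub_optQueue_le I u q h
    rwa [length_of_mem_support_trajLaw I pol _ h hh] at this
  have hmap : ∀ q, expect ((trajLaw I pol (t + 1)).map fun h => (q, h))
      (fun x => (queue u x.1 x.2 : ℝ) - (optQueue I u x.1 x.2 : ℝ)) =
      expect (trajLaw I pol (t + 1)) fun h => (queue u q h : ℝ) - (optQueue I u q h : ℝ) :=
    fun q => expect_map _ _ (fun _ _ h => (Prod.mk.inj h).2) _
  rw [regret, expect_bind_of_bound _ _ _ (2 * (t + 1 : ℕ))]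
  · simp only [hmap]
    rw [← expect_const π (I.lam u * I.gap * missProb I pol u t)]
    refine expect_mono_of_summable ((summable_toReal π).mul_right _)
      (summable_of_bound π _ (2 * (t + 1 : ℕ)) fun q _ => ?_)
      fun q _ => le_expect_queue_sub_optQueue I pol u q t
    have hfin := finite_support_trajLaw I pol (t + 1)
    rw [abs_le]
    constructor
    · rw [← expect_const (trajLaw I pol (t + 1)) (-(2 * ((t + 1 : ℕ) : ℝ)))]
      exact expect_mono hfin fun h hh => (abs_le.1 (hC q h hh)).1
    · rw [← expect_const (trajLaw I pol (t + 1)) (2 * ((t + 1 : ℕ) : ℝ))]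
      exact expect_mono hfin fun h hh => (abs_le.1 (hC q h hh)).2
  · rintro ⟨q, h⟩ hx
    simp only [PMF.mem_support_bind_iff, PMF.mem_support_map_iff] at hx
    obtain ⟨q', -, h', hh', heq⟩ := hx
    obtain ⟨rfl, rfl⟩ := Prod.mk.inj heq
    exact hC _ _ hh'

end Queue

/-! ### Change of measure -/

section ChangeOfMeasure

variable {U K : ℕ}

/-- The Kullback-Leibler divergence between Bernoulli laws, as a real number. -/
def coinKL (p q : unitInterval) : ℝ :=
  expect (coin p) fun b => Real.log (mass p b / mass q b)

/-- The log-likelihood ratio of the instance `I'` against `I` in one slot, counting only the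
services that the scheduler observes. -/
def slotLLR (I I' : Instance U K) (s : Slot U K) : ℝ :=
  ∑ p : Fin U × Fin K, if s.matching p.1 = some p.2 then
    Real.log (mass (I'.mu p.1 p.2) (s.service p) / mass (I.mu p.1 p.2) (s.service p)) else 0

/-- The log-likelihood ratio of the instance `I'` against `I` of the observations of a history. -/
def llr (I I' : Instance U K) (h : List (Slot U K)) : ℝ := (h.map (slotLLR I I')).sum

/-- The service laws of `I` are absolutely continuous with respect to those of `I'`. -/
def ServiceAC (I I' : Instance U K) : Prop :=
  ∀ u k b, mass (I'.mu u k) b = 0 → mass (I.mu u k) b = 0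

/-- The one-step change of measure is only an inequality, since `I'` may charge outcomes that are
impossible under `I`. -/
lemma slotMean_exp_slotLLR_mul_le {I I' : Instance U K} (hlam : I.lam = I'.lam)
    (hac : ServiceAC I I') (m : Fin U ≃. Fin K) {g : Obs U K → ℝ} (hg : ∀ o, 0 ≤ g o) :
    slotMean I m (fun s => Real.exp (slotLLR I I' s) * g s.obs) ≤
      slotMean I' m fun s => g s.obs := by
  unfold slotMean
  rw [hlam]
  refine expect_mono (Set.toFinite _) fun a _ => ?_
  -- An instance that follows `I'` on the matched pairs and `I` elsewhere has the same observations
  -- as `I'`, and its density with respect to `I` is the observed likelihood ratio.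
  let ν : Fin U × Fin K → unitInterval := fun p =>
    if m p.1 = some p.2 then I'.mu p.1 p.2 else I.mu p.1 p.2
  have h2 : expect (coins ν) (fun r => g (Slot.obs ⟨a, m, r⟩)) =
      expect (coins fun p : Fin U × Fin K => I'.mu p.1 p.2) fun r => g (Slot.obs ⟨a, m, r⟩) := by
    refine expect_coins_congr (fun p : Fin U × Fin K => m p.1 = some p.2) (fun p hp => ?_)
      fun x y hxy => ?_
    · simp [ν, hp]
    · have : Slot.offered ⟨a, m, x⟩ = Slot.offered ⟨a, m, y⟩ := by
        funext u
        unfold Slot.offered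
        cases hm : m u with
        | none => simp
        | some k => simpa [hm] using hxy (u, k) hm
      simp only [Slot.obs, this]
  rw [← h2, expect_coins, expect_coins]
  refine Finset.sum_le_sum fun r _ => ?_
  rw [← mul_assoc]
  refine mul_le_mul_of_nonneg_right ?_ (hg _)
  rw [slotLLR, Real.exp_sum, ← Finset.prod_mul_distrib]
  refine Finset.prod_le_prod
    (fun p _ => mul_nonneg (mass_nonneg _ _) (Real.exp_pos _).le) fun p _ => ?_
  by_cases hp : m p.1 = some p.2
  · simp only [ν, hp, if_true]
    rcases (mass_nonneg (I.mu p.1 p.2) (r p)).eq_or_lt with h0 | h0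
    · rw [← h0, zero_mul]
      exact mass_nonneg _ _
    · have h1 : 0 < mass (I'.mu p.1 p.2) (r p) :=
        (mass_nonneg _ _).lt_of_ne fun h => h0.ne' (hac _ _ _ h.symm)
      rw [Real.exp_log (div_pos h1 h0), mul_div_cancel₀ _ h0.ne']
  · simp [ν, hp]

lemma expect_exp_llr_mul_le {I I' : Instance U K} (hlam : I.lam = I'.lam)
    (hac : ServiceAC I I') (pol : Policy U K) (t : ℕ) {g : List (Obs U K) → ℝ}
    (hg : ∀ o, 0 ≤ g o) :
    expect (trajLaw I pol t) (fun h => Real.exp (llr I I' h) * g (h.map Slot.obs)) ≤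
      expect (trajLaw I' pol t) fun h => g (h.map Slot.obs) := by
  induction t generalizing g with
  | zero => simp [trajLaw, expect_pure, llr]
  | succ t ih =>
    rw [expect_trajLaw_succ, expect_trajLaw_succ]
    refine le_trans ?_ (ih (g := fun l => expect (pol l) fun m =>
      slotMean I' m fun s => g (s.obs :: l)) fun l => expect_nonneg fun m =>
        expect_nonneg fun a => expect_nonneg fun r => hg _)
    refine expect_mono (finite_support_trajLaw I pol t) fun h _ => ?_
    rw [← expect_const_mul]
    refine expect_mono (Set.toFinite _) fun m _ => ?_
    refine le_trans (le_of_eq ?_) (mul_le_mul_of_nonneg_left (slotMean_exp_slotLLR_mul_le hlam hac m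
      (g := fun o => g (o :: h.map Slot.obs)) fun o => hg _) (Real.exp_pos (llr I I' h)).le)
    rw [← slotMean_const_mul]
    congr 1
    funext s
    rw [llr, List.map_cons, List.sum_cons, Real.exp_add, List.map_cons, llr]
    ring

lemma expect_coin_log (p q : unitInterval) :
    expect (coin p) (fun b => Real.log (mass q b / mass p b)) = -coinKL p q := by
  rw [coinKL, ← neg_one_mul, ← expect_const_mul]
  refine expect_congr fun b _ => ?_
  rw [← inv_div, Real.log_inv, neg_one_mul]

lemma slotMean_slotLLR (I I' : Instance U K) (m : Fin U ≃. Fin K) :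
    slotMean I m (slotLLR I I') = slotMean I m fun s => ∑ p : Fin U × Fin K,
      if s.matching p.1 = some p.2 then -coinKL (I.mu p.1 p.2) (I'.mu p.1 p.2) else 0 := by
  unfold slotLLR
  rw [slotMean_sum, slotMean_sum]
  refine Finset.sum_congr rfl fun p _ => ?_
  rw [slotMean_of_matching I m fun m => if m p.1 = some p.2 then
    -coinKL (I.mu p.1 p.2) (I'.mu p.1 p.2) else 0]
  by_cases hp : m p.1 = some p.2
  · rw [if_pos hp, ← expect_coin_log, ← slotMean_service I m p]
    simp only [slotMean, hp, if_true]
  · rw [if_neg hp]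
    simp only [slotMean, hp, if_false, expect_const]

/-- The mean number of slots in which server `k` is assigned to queue `u`. -/
def meanPlays (I : Instance U K) (pol : Policy U K) (u : Fin U) (k : Fin K) (t : ℕ) : ℝ :=
  expect (trajLaw I pol t) fun h => (plays u k h : ℝ)

/-- The divergence of the observations: each assignment of a pair contributes the divergence
between its two service laws. -/
lemma expect_llr (I I' : Instance U K) (pol : Policy U K) (t : ℕ) :
    expect (trajLaw I pol t) (llr I I') =
      -∑ p : Fin U × Fin K, coinKL (I.mu p.1 p.2) (I'.mu p.1 p.2) *
        meanPlays I pol p.1 p.2 t := by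
  have h := expect_additive_congr I pol (slotMean_slotLLR I I') t
  refine h.trans ?_
  have e : ∀ h : List (Slot U K), (h.map fun s => ∑ p : Fin U × Fin K,
      if s.matching p.1 = some p.2 then -coinKL (I.mu p.1 p.2) (I'.mu p.1 p.2) else 0).sum =
      ∑ p : Fin U × Fin K, -coinKL (I.mu p.1 p.2) (I'.mu p.1 p.2) * (plays p.1 p.2 h : ℝ) := by
    intro h
    induction h with
    | nil => simp [plays]
    | cons s h ih =>
      rw [List.map_cons, List.sum_cons, ih, ← Finset.sum_add_distrib]
      refine Finset.sum_congr rfl fun p _ => ?_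
      by_cases hp : s.matching p.1 = some p.2
      · simp [plays, hp]
        ring
      · simp [plays, hp]
  simp only [e]
  rw [expect_sum (finite_support_trajLaw I pol t), ← Finset.sum_neg_distrib]
  refine Finset.sum_congr rfl fun p _ => ?_
  rw [expect_const_mul, neg_mul, meanPlays]

/-- If an observable event (the set where `g = 1`, for a `g` with values in `[0, 1]`) has mean at
least one half under `I`, then its mean under `I'` is not much smaller than the exponential of minus
twice the divergence. -/
lemma half_mul_exp_le_expect {I I' : Instance U K} (hlam : I.lam = I'.lam)
    (hac : ServiceAC I I') (pol : Policy U K) (t : ℕ) {g : List (Obs U K) → ℝ}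
    (hg : ∀ o, 0 ≤ g o) (hg1 : ∀ o, g o ≤ 1)
    (hhalf : 1 / 2 ≤ expect (trajLaw I pol t) fun h => g (h.map Slot.obs)) :
    1 / 2 * Real.exp (-(2 * (-expect (trajLaw I pol t) (llr I I') + 1))) ≤
      expect (trajLaw I' pol t) fun h => g (h.map Slot.obs) := by
  have hfin := finite_support_trajLaw I pol t
  have hfin' := finite_support_trajLaw I' pol t
  set κ := -expect (trajLaw I pol t) (llr I I') with hκ
  -- Writing `ℓ` for `llr I I' h`, the tangent bound `exp ℓ ≥ exp (-x) * (1 + ℓ + x)` with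
  -- `x = 2 * (κ + 1)` is used on the event, and `ℓ ≤ exp ℓ` off it.
  set x := 2 * (κ + 1) with hx
  have h1 := expect_exp_llr_mul_le hlam hac pol t hg
  have h2 := expect_exp_llr_mul_le hlam hac pol t (g := fun o => 1 - g o)
    fun o => sub_nonneg.2 (hg1 o)
  have h3 : expect (trajLaw I' pol t) (fun h => 1 - g (h.map Slot.obs)) ≤ 1 := by
    rw [expect_sub hfin' (fun _ => (1 : ℝ)), expect_const]
    linarith [expect_nonneg (p := trajLaw I' pol t)
      (f := fun h => g (h.map Slot.obs)) fun h => hg _]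
  have h4 : expect (trajLaw I pol t) (llr I I') +
      (1 + x) * expect (trajLaw I pol t) (fun h => g (h.map Slot.obs)) ≤
      Real.exp x * expect (trajLaw I pol t)
        (fun h => Real.exp (llr I I' h) * g (h.map Slot.obs)) +
      expect (trajLaw I pol t)
        (fun h => Real.exp (llr I I' h) * (1 - g (h.map Slot.obs))) := by
    rw [← expect_const_mul, ← expect_const_mul, ← expect_add hfin, ← expect_add hfin]
    refine expect_mono hfin fun h _ => ?_
    set ℓ := llr I I' h
    have a1 : ℓ + x + 1 ≤ Real.exp x * Real.exp ℓ := by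
      rw [← Real.exp_add, add_comm x]
      exact Real.add_one_le_exp _
    have a2 : ℓ ≤ Real.exp ℓ := by linarith [Real.add_one_le_exp ℓ]
    have b1 := mul_le_mul_of_nonneg_right a1 (hg (h.map Slot.obs))
    have b2 := mul_le_mul_of_nonneg_right a2 (sub_nonneg.2 (hg1 (h.map Slot.obs)))
    linarith
  have hκ0 : 0 ≤ 1 + x := by
    -- the divergence exceeds `-1`, again by `ℓ ≤ exp ℓ`
    have h5 := expect_exp_llr_mul_le hlam hac pol t (g := fun _ => 1) fun _ => zero_le_one
    rw [expect_const] at h5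
    have h6 : expect (trajLaw I pol t) (llr I I') ≤
        expect (trajLaw I pol t) fun h => Real.exp (llr I I' h) * 1 :=
      expect_mono hfin fun h _ => by linarith [Real.add_one_le_exp (llr I I' h)]
    linarith
  have h5 := mul_le_mul_of_nonneg_left hhalf hκ0
  have h6 : 1 / 2 ≤ Real.exp x * expect (trajLaw I pol t)
      (fun h => Real.exp (llr I I' h) * g (h.map Slot.obs)) := by linarith
  rw [Real.exp_neg]
  have hpos := Real.exp_pos x
  rw [← div_eq_mul_inv, div_le_iff₀ hpos]
  nlinarith [mul_le_mul_of_nonneg_left h1 hpos.le]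

end ChangeOfMeasure

/-! ### Counting assignments -/

section Counting

variable {U K : ℕ}

/-- The number of slots in which queue `u` does not get its best server. -/
def misses (I : Instance U K) (u : Fin U) (h : List (Slot U K)) : ℝ :=
  (h.map fun s => miss I u s.matching).sum

lemma expect_misses (I : Instance U K) (pol : Policy U K) (u : Fin U) (t : ℕ) :
    expect (trajLaw I pol t) (misses I u) = ∑ s ∈ Finset.range t, missProb I pol u s := by
  induction t with
  | zero => simp [trajLaw, expect_pure, misses]
  | succ t ih =>
    rw [Finset.sum_range_succ, ← ih, add_comm (expect _ _)]
    refine (expect_additive_succ I pol t fun s => miss I u s.matching).trans ?_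
    simp only [slotMean_of_matching I _ (miss I u)]
    rfl

lemma plays_cons (u : Fin U) (k : Fin K) (s : Slot U K) (h : List (Slot U K)) :
    (plays u k (s :: h) : ℝ) = plays u k h + if s.matching u = some k then 1 else 0 := by
  by_cases hs : s.matching u = some k <;> simp [plays, hs]

lemma misses_cons (I : Instance U K) (u : Fin U) (s : Slot U K) (h : List (Slot U K)) :
    misses I u (s :: h) = misses I u h + miss I u s.matching := by
  simp [misses, add_comm]

lemma plays_best_add_misses (I : Instance U K) (u : Fin U) (h : List (Slot U K)) :
    (plays u (I.best u) h : ℝ) + misses I u h = h.length := by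
  induction h with
  | nil => simp [plays, misses]
  | cons s h ih =>
    rw [plays_cons, misses_cons, List.length_cons, Nat.cast_succ, ← ih, miss]
    split_ifs <;> ring

lemma sum_meanPlays_le (I : Instance U K) (pol : Policy U K) (u : Fin U) {ι : Type}
    (A : Finset ι) (f : ι → Fin U × Fin K)
    (hf : ∀ m : Fin U ≃. Fin K,
      ∑ i ∈ A, (if m (f i).1 = some (f i).2 then (1 : ℝ) else 0) ≤ miss I u m) (t : ℕ) :
    ∑ i ∈ A, meanPlays I pol (f i).1 (f i).2 t ≤ expect (trajLaw I pol t) (misses I u) := by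
  have hfin := finite_support_trajLaw I pol t
  unfold meanPlays
  rw [← expect_sum hfin A fun i h => (plays (f i).1 (f i).2 h : ℝ)]
  have key : ∀ h : List (Slot U K),
      ∑ i ∈ A, (plays (f i).1 (f i).2 h : ℝ) ≤ misses I u h := by
    intro h
    induction h with
    | nil => simp [plays, misses]
    | cons s h ih =>
      simp only [plays_cons, misses_cons, Finset.sum_add_distrib]
      exact add_le_add ih (hf _)
  exact expect_mono hfin fun h _ => key h

lemma sum_indicator_le_miss (I : Instance U K) (u : Fin U) (m : Fin U ≃. Fin K) {ι : Type}
    (A : Finset ι) (P : ι → Prop) [DecidablePred P]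
    (h1 : ∀ i ∈ A, ∀ j ∈ A, P i → P j → i = j)
    (h0 : m u = some (I.best u) → ∀ i ∈ A, ¬ P i) :
    ∑ i ∈ A, (if P i then (1 : ℝ) else 0) ≤ miss I u m := by
  unfold miss
  split_ifs with h
  · exact (Finset.sum_eq_zero fun i hi => if_neg (h0 h i hi)).le
  · rw [Finset.sum_boole]
    exact_mod_cast Finset.card_le_one.2 fun i hi j hj =>
      h1 i (Finset.mem_filter.1 hi).1 j (Finset.mem_filter.1 hj).1
        (Finset.mem_filter.1 hi).2 (Finset.mem_filter.1 hj).2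

end Counting

/-! ### Alternative instances -/

section Alternative

variable {U K : ℕ}

/-- The instance in which the best servers are `b`, made so by raising to `q` the service rate of
each queue at its new best server, where that differs from the old one. -/
def altInstance (I : Instance U K) (b : Fin U → Fin K) (hb : Function.Injective b)
    (q : unitInterval) (hq : ∀ u k, I.mu u k < q) : Instance U K where
  lam := I.lam
  mu u k := if k = b u ∧ b u ≠ I.best u then q else I.mu u k
  best := b
  mu_lt_best u k hk := by
    by_cases h : b u = I.best u
    · simpa [h] using I.mu_lt_best u k (h ▸ hk)
    · simpa [h, hk] using hq u k
  best_injective := hb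
  stable u := by
    by_cases h : b u = I.best u
    · simpa [h] using I.stable u
    · simpa [h] using (I.stable u).trans (hq u _)

lemma coinKL_self (p : unitInterval) : coinKL p p = 0 := by
  rw [coinKL, expect_congr (g := fun _ => 0), expect_const]
  intro b _
  by_cases h : mass p b = 0
  · simp [h]
  · simp [div_self h]

lemma serviceAC_altInstance (I : Instance U K) (b : Fin U → Fin K) (hb : Function.Injective b)
    (q : unitInterval) (hq : ∀ u k, I.mu u k < q) (hq1 : q < 1) :
    ServiceAC I (altInstance I b hb q hq) := by
  intro u k c hc
  by_cases h : k = b u ∧ b u ≠ I.best u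
  · exfalso
    have h0 : (0 : ℝ) < q := (I.mu u k).2.1.trans_lt (hq u k)
    have h1 : (q : ℝ) < 1 := hq1
    simp only [altInstance, if_pos h] at hc
    cases c
    · rw [mass_false] at hc; linarith
    · rw [mass_true] at hc; linarith
  · simpa only [altInstance, if_neg h] using hc

lemma meanPlays_nonneg (I : Instance U K) (pol : Policy U K) (u : Fin U) (k : Fin K) (t : ℕ) :
    0 ≤ meanPlays I pol u k t := expect_nonneg fun _ => Nat.cast_nonneg _

lemma neg_expect_llr_altInstance_le (I : Instance U K) (b : Fin U → Fin K)
    (hb : Function.Injective b) (q : unitInterval) (hq : ∀ u k, I.mu u k < q) {d : ℝ}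
    (hd : ∀ u k, coinKL (I.mu u k) q ≤ d) (pol : Policy U K) (t : ℕ) :
    -expect (trajLaw I pol t) (llr I (altInstance I b hb q hq)) ≤
      d * ∑ u, if b u ≠ I.best u then meanPlays I pol u (b u) t else 0 := by
  rw [expect_llr, neg_neg, Fintype.sum_prod_type, Finset.mul_sum]
  refine Finset.sum_le_sum fun u _ => ?_
  rw [Finset.sum_eq_single (b u)]
  · by_cases h : b u ≠ I.best u
    · simp only [altInstance, h, ne_eq, not_false_eq_true, and_self, if_true]
      exact mul_le_mul_of_nonneg_right (hd _ _) (meanPlays_nonneg _ _ _ _ _)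
    · simp [altInstance, h, coinKL_self]
  · intro k _ hk
    simp [altInstance, hk, coinKL_self]
  · simp

/-- The logarithmic lower bound on the mean number of assignments that tell the alternative instance
apart, as long as queue `u` mostly gets its best server: under the alternative instance, where the
best server of `u` is another one, consistency makes that improbable. -/
lemma mul_log_le_sum_meanPlays (I : Instance U K) (b : Fin U → Fin K)
    (hb : Function.Injective b) (q : unitInterval) (hq : ∀ u k, I.mu u k < q) (hq1 : q < 1)
    {d : ℝ} (hd0 : 0 < d) (hd : ∀ u k, coinKL (I.mu u k) q ≤ d) {pol : Policy U K} {α : ℝ}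
    (hpol : IsConsistent pol α) {u : Fin U} (hu : b u ≠ I.best u)
    (hmiss : ∀ᶠ t : ℕ in atTop, expect (trajLaw I pol t) (misses I u) ≤ (t : ℝ) / 4)
    {c : ℝ} (hc : c < (1 - α) / (2 * d)) :
    ∀ᶠ t : ℕ in atTop, c * Real.log t ≤
      ∑ v, if b v ≠ I.best v then meanPlays I pol v (b v) t else 0 := by
  set I' := altInstance I b hb q hq with hI'
  obtain ⟨C, hC0, hC⟩ := (hpol I' u (I.best u) hu.symm).exists_pos
  rw [isBigOWith_iff] at hC
  have hlog : Tendsto (fun t : ℕ => Real.log (t : ℝ)) atTop atTop :=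
    Real.tendsto_log_atTop.comp tendsto_natCast_atTop_atTop
  have hslack : 0 < (1 - α) - c * (2 * d) := by
    rw [lt_div_iff₀ (by positivity)] at hc
    linarith
  filter_upwards [hC, hmiss, eventually_ge_atTop 1,
    hlog.eventually_ge_atTop ((Real.log (4 * C) + 2) / ((1 - α) - c * (2 * d)))]
    with t hCt hmt ht1 hlt
  have ht : (0 : ℝ) < t := by exact_mod_cast ht1
  set S := ∑ v, if b v ≠ I.best v then meanPlays I pol v (b v) t else 0
  have hκ := neg_expect_llr_altInstance_le I b hb q hq hd pol t
  -- the event that `u` gets server `I.best u` in more than half of the slots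
  let g : List (Obs U K) → ℝ := fun o =>
    if o.length < 2 * o.countP (fun x => x.matching u = some (I.best u)) then 1 else 0
  have hg : ∀ o, 0 ≤ g o := fun o => by simp only [g]; split_ifs <;> norm_num
  have hg1 : ∀ o, g o ≤ 1 := fun o => by simp only [g]; split_ifs <;> norm_num
  have hgh : ∀ h : List (Slot U K), g (h.map Slot.obs) =
      if h.length < 2 * plays u (I.best u) h then 1 else 0 := by
    intro h
    simp only [g, List.length_map, List.countP_map, plays]
    rfl
  have hfin := finite_support_trajLaw I pol t
  have hfin' := finite_support_trajLaw I' pol t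
  have hhalf : 1 / 2 ≤ expect (trajLaw I pol t) fun h => g (h.map Slot.obs) := by
    have h1 : expect (trajLaw I pol t) (fun h => 1 - 2 / t * misses I u h) ≤
        expect (trajLaw I pol t) fun h => g (h.map Slot.obs) := by
      refine expect_mono hfin fun h hh => ?_
      have hlen := length_of_mem_support_trajLaw I pol t h hh
      have hsum := plays_best_add_misses I u h
      rw [hgh]
      rw [hlen] at hsum ⊢
      have hm0 : 0 ≤ misses I u h := by
        refine List.sum_nonneg fun x hx => ?_
        obtain ⟨s, -, rfl⟩ := List.mem_map.1 hx
        exact miss_nonneg _ _ _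
      split_ifs with hif
      · have : 0 ≤ 2 / (t : ℝ) * misses I u h := by positivity
        linarith
      · push Not at hif
        rify at hif
        rw [div_mul_eq_mul_div, sub_nonpos, le_div_iff₀ ht]
        linarith
    rw [expect_sub hfin (fun _ => (1 : ℝ)), expect_const, expect_const_mul] at h1
    have h2 : 2 / (t : ℝ) * expect (trajLaw I pol t) (misses I u) ≤ 2 / t * (t / 4) :=
      mul_le_mul_of_nonneg_left hmt (by positivity)
    have h3 : 2 / (t : ℝ) * (t / 4) = 1 / 2 := by field_simp; norm_num
    change 1 - 2 / (t : ℝ) * expect (trajLaw I pol t) (misses I u) ≤ _ at h1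
    linarith
  have hI'g : expect (trajLaw I' pol t) (fun h => g (h.map Slot.obs)) ≤
      2 / t * (C * (t : ℝ) ^ α) := by
    have h1 : expect (trajLaw I' pol t) (fun h => g (h.map Slot.obs)) ≤
        expect (trajLaw I' pol t) fun h => 2 / t * (plays u (I.best u) h : ℝ) := by
      refine expect_mono hfin' fun h hh => ?_
      rw [hgh, length_of_mem_support_trajLaw I' pol t h hh]
      split_ifs with hif
      · rify at hif
        rw [div_mul_eq_mul_div, le_div_iff₀ ht]
        linarith
      · positivity
    rw [expect_const_mul] at h1
    refine h1.trans (mul_le_mul_of_nonneg_left ?_ (by positivity))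
    rw [Real.norm_eq_abs, Real.norm_eq_abs, abs_of_nonneg (Real.rpow_nonneg ht.le α)] at hCt
    exact (le_abs_self _).trans hCt
  have hmain := (half_mul_exp_le_expect (I := I) (I' := I') rfl
    (serviceAC_altInstance I b hb q hq hq1) pol t hg hg1 hhalf).trans hI'g
  have hexp : Real.exp (-(2 * (-expect (trajLaw I pol t) (llr I I') + 1))) ≤
      4 * C * (t : ℝ) ^ (α - 1) := by
    rw [Real.rpow_sub_one ht.ne']
    have : 2 / (t : ℝ) * (C * (t : ℝ) ^ α) = 1 / 2 * (4 * C * ((t : ℝ) ^ α / t)) := by ring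
    linarith
  have hlogs := Real.log_le_log (Real.exp_pos _) hexp
  rw [Real.log_exp, Real.log_mul (by positivity) (Real.rpow_pos_of_pos ht _).ne',
    Real.log_rpow ht] at hlogs
  rw [div_le_iff₀ hslack] at hlt
  have h2d : c * Real.log t * (2 * d) ≤ S * (2 * d) := by
    linarith
  exact le_of_mul_le_mul_right h2d (by positivity)

end Alternative

/-! ### Divergence between Bernoulli laws -/

section Divergence

lemma coinKL_eq (p q : unitInterval) : coinKL p q =
    p * Real.log (p / q) + (1 - p) * Real.log ((1 - p) / (1 - q)) := by
  rw [coinKL, expect_coin, mass_true, mass_true, mass_false, mass_false]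

lemma mul_log_div_eq {x q : ℝ} (hq : q ≠ 0) :
    x * Real.log (x / q) = x * Real.log x - x * Real.log q := by
  by_cases hx : x = 0
  · simp [hx]
  · rw [Real.log_div hx hq, mul_sub]

/-- The divergence from the law of mean `q` decreases as the first mean increases to `q`, by
convexity. -/
lemma bernoulli_divergence_anti {m x q : ℝ} (hm : 0 ≤ m) (hmx : m ≤ x) (hxq : x ≤ q) (hq0 : 0 < q)
    (hq1 : q < 1) (h0 : 0 ≤ m * Real.log (m / q) + (1 - m) * Real.log ((1 - m) / (1 - q))) :
    x * Real.log (x / q) + (1 - x) * Real.log ((1 - x) / (1 - q)) ≤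
      m * Real.log (m / q) + (1 - m) * Real.log ((1 - m) / (1 - q)) := by
  have hq1' : 1 - q ≠ 0 := by linarith
  rcases (hmx.trans hxq).eq_or_lt with h | h
  · obtain rfl : m = x := by linarith
    exact le_rfl
  have hqm : 0 < q - m := sub_pos.2 h
  set θ := (q - x) / (q - m) with hθ
  have hθ0 : 0 ≤ θ := div_nonneg (by linarith) hqm.le
  have hθ1 : θ ≤ 1 := (div_le_one hqm).2 (by linarith)
  have hx : x = θ * m + (1 - θ) * q := by
    rw [hθ]; field_simp; ring
  have c1 := Real.convexOn_mul_log.2 (Set.mem_Ici.2 hm) (Set.mem_Ici.2 hq0.le) hθ0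
    (sub_nonneg.2 hθ1) (by ring)
  have c2 := Real.convexOn_mul_log.2 (x := 1 - m) (y := 1 - q) (Set.mem_Ici.2 (by linarith))
    (Set.mem_Ici.2 (by linarith)) hθ0 (sub_nonneg.2 hθ1) (by ring)
  simp only [smul_eq_mul] at c1 c2
  rw [← hx] at c1
  rw [show θ * (1 - m) + (1 - θ) * (1 - q) = 1 - x by rw [hx]; ring] at c2
  have h1 := mul_le_mul_of_nonneg_right hθ1 h0
  simp only [mul_log_div_eq hq0.ne', mul_log_div_eq hq1'] at h1 h0 ⊢
  have e1 : x * Real.log q = (θ * m + (1 - θ) * q) * Real.log q := by rw [← hx]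
  have e2 : (1 - x) * Real.log (1 - q) =
      (θ * (1 - m) + (1 - θ) * (1 - q)) * Real.log (1 - q) := by rw [hx]; ring
  linarith

end Divergence

/-! ### The lower bound -/

section LowerBound

variable {U K : ℕ}

/-- The factor by which the need to reject alternative instances multiplies the misses of one queue:
the maximum of `K - U`, since each of the servers that are nobody's best must be tried by the queue,
and of `(U - 1) / 2`, since each of the `U - 1` exchanges of best servers with another queue must be
tried by one of the two queues, either way at the cost of a miss, and one miss can count for two
exchanges. -/
def tests (U K : ℕ) : ℝ := max (((U : ℝ) - 1) / 2) ((K : ℝ) - U)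

lemma mul_log_le_misses (I : Instance U K) (q : unitInterval) (hq : ∀ u k, I.mu u k < q)
    (hq1 : q < 1) {d : ℝ} (hd0 : 0 < d) (hd : ∀ u k, coinKL (I.mu u k) q ≤ d) {pol : Policy U K}
    {α : ℝ} (hpol : IsConsistent pol α) (u : Fin U)
    (hmiss : ∀ᶠ t : ℕ in atTop, expect (trajLaw I pol t) (misses I u) ≤ (t : ℝ) / 4)
    {c : ℝ} (hc : c < (1 - α) / (2 * d)) :
    ∀ᶠ t : ℕ in atTop, tests U K * (c * Real.log t) ≤ expect (trajLaw I pol t) (misses I u) := by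
  classical
  have hinj := I.best_injective
  have hfree : ∀ᶠ t : ℕ in atTop, ∀ k ∈ (Finset.univ.image I.best)ᶜ,
      c * Real.log t ≤ meanPlays I pol u k t := by
    rw [Filter.eventually_all_finset]
    intro k hk
    have hk' : ∀ v, I.best v ≠ k := by simpa using hk
    have hb : Function.Injective (Function.update I.best u k) := by
      intro v w hvw
      by_cases hv : v = u <;> by_cases hw : w = u
      · rw [hv, hw]
      · subst hv
        rw [Function.update_self, Function.update_of_ne hw] at hvw
        exact absurd hvw.symm (hk' w)
      · subst hw
        rw [Function.update_self, Function.update_of_ne hv] at hvw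
        exact absurd hvw (hk' v)
      · rw [Function.update_of_ne hv, Function.update_of_ne hw] at hvw
        exact hinj hvw
    have hu : Function.update I.best u k u ≠ I.best u := by
      rw [Function.update_self]
      exact (hk' u).symm
    filter_upwards [mul_log_le_sum_meanPlays I _ hb q hq hq1 hd0 hd hpol hu hmiss hc] with t ht
    rw [Finset.sum_eq_single u] at ht
    · rwa [if_pos hu, Function.update_self] at ht
    · intro v _ hv
      simp [Function.update_of_ne hv]
    · simp
  have hswap : ∀ᶠ t : ℕ in atTop, ∀ v ∈ Finset.univ.erase u,
      c * Real.log t ≤ meanPlays I pol u (I.best v) t + meanPlays I pol v (I.best u) t := by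
    rw [Filter.eventually_all_finset]
    intro v hv
    have hvu : v ≠ u := Finset.ne_of_mem_erase hv
    have hb : Function.Injective (I.best ∘ Equiv.swap u v) := hinj.comp (Equiv.injective _)
    have hu : (I.best ∘ Equiv.swap u v) u ≠ I.best u := by
      simpa using hinj.ne hvu
    have hv' : (I.best ∘ Equiv.swap u v) v ≠ I.best v := by
      simpa using hinj.ne hvu.symm
    filter_upwards [mul_log_le_sum_meanPlays I _ hb q hq hq1 hd0 hd hpol hu hmiss hc] with t ht
    rw [← Finset.sum_subset (Finset.subset_univ {u, v}), Finset.sum_pair hvu.symm, if_pos hu,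
      if_pos hv'] at ht
    · simpa using ht
    · intro w _ hw
      simp only [Finset.mem_insert, Finset.mem_singleton, not_or] at hw
      simp [Equiv.swap_apply_of_ne_of_ne hw.1 hw.2]
  filter_upwards [hfree, hswap] with t hfree hswap
  have hcardF : (((Finset.univ.image I.best)ᶜ.card : ℕ) : ℝ) = (K : ℝ) - U := by
    have hle : U ≤ K := by simpa using Fintype.card_le_of_injective _ hinj
    rw [Finset.card_compl, Finset.card_image_of_injective _ hinj, Finset.card_univ,
      Fintype.card_fin, Fintype.card_fin, Nat.cast_sub hle]
  have hcardE : (((Finset.univ.erase u).card : ℕ) : ℝ) = (U : ℝ) - 1 := by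
    rw [Finset.card_erase_of_mem (Finset.mem_univ u), Finset.card_univ, Fintype.card_fin,
      Nat.cast_sub (Nat.one_le_of_lt u.2), Nat.cast_one]
  have h1 := Finset.sum_le_sum hfree
  have h2 := Finset.sum_le_sum hswap
  rw [Finset.sum_const, nsmul_eq_mul, hcardF] at h1
  rw [Finset.sum_const, nsmul_eq_mul, hcardE, Finset.sum_add_distrib] at h2
  have g1 := sum_meanPlays_le I pol u (Finset.univ.image I.best)ᶜ (fun k => (u, k))
    (fun m => sum_indicator_le_miss I u m _ (fun k => m u = some k)
      (fun i _ j _ hi hj => Option.some_injective _ (hi.symm.trans hj))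
      fun h i hi hmi => by
        rw [h] at hmi
        obtain rfl := Option.some_injective _ hmi
        simp at hi) t
  have g2 := sum_meanPlays_le I pol u (Finset.univ.erase u) (fun v => (u, I.best v))
    (fun m => sum_indicator_le_miss I u m _ (fun v => m u = some (I.best v))
      (fun i _ j _ hi hj => hinj (Option.some_injective _ (hi.symm.trans hj)))
      fun h i hi hmi => Finset.ne_of_mem_erase hi
        (hinj (Option.some_injective _ (h.symm.trans hmi))).symm) t
  have g3 := sum_meanPlays_le I pol u (Finset.univ.erase u) (fun v => (v, I.best u))
    (fun m => sum_indicator_le_miss I u m _ (fun v => m v = some (I.best u))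
      (fun i _ j _ hi hj => m.inj hi hj)
      fun h i hi hmi => Finset.ne_of_mem_erase hi (m.inj hmi h)) t
  simp only at g1 g2 g3
  rcases max_choice (((U : ℝ) - 1) / 2) ((K : ℝ) - U) with h | h <;> rw [tests, h] <;> linarith

/-- A sequence that is eventually below `c / (t + 1)` has partial sums of size at most
`c * log t` up to a constant. -/
lemma exists_sum_le_log {f : ℕ → ℝ} (hf : ∀ t, 0 ≤ f t) {c : ℝ} (hc : 0 ≤ c)
    (h : ∀ᶠ t : ℕ in atTop, f t ≤ c * (1 / ((t : ℝ) + 1))) :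
    ∃ C, ∀ t : ℕ, ∑ s ∈ Finset.range t, f s ≤ c * Real.log t + C := by
  obtain ⟨T, hT⟩ := eventually_atTop.1 h
  refine ⟨c + ∑ s ∈ Finset.range T, f s, fun t => ?_⟩
  have h1 : ∀ s, f s ≤ c * (1 / ((s : ℝ) + 1)) + if s < T then f s else 0 := by
    intro s
    split_ifs with hs
    · have : 0 ≤ c * (1 / ((s : ℝ) + 1)) := by positivity
      linarith
    · simpa using hT s (not_lt.1 hs)
  have h2 : ∑ s ∈ Finset.range t, (1 / ((s : ℝ) + 1)) ≤ 1 + Real.log t := by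
    refine le_trans (le_of_eq ?_) (harmonic_le_one_add_log t)
    simp [harmonic]
  have h3 : ∑ s ∈ Finset.range t, (if s < T then f s else 0) ≤ ∑ s ∈ Finset.range T, f s := by
    rw [← Finset.sum_filter]
    refine Finset.sum_le_sum_of_subset_of_nonneg (fun s hs => ?_) fun s _ _ => hf s
    exact Finset.mem_range.2 (Finset.mem_filter.1 hs).2
  have h4 := Finset.sum_le_sum fun s (_ : s ∈ Finset.range t) => h1 s
  rw [Finset.sum_add_distrib, ← Finset.mul_sum] at h4
  linarith [mul_le_mul_of_nonneg_left h2 hc]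

lemma frequently_le_sum_missProb (I : Instance U K) (q : unitInterval)
    (hq : ∀ u k, I.mu u k < q) (hq1 : q < 1) {d : ℝ} (hd0 : 0 < d)
    (hd : ∀ u k, coinKL (I.mu u k) q ≤ d) {pol : Policy U K} {α : ℝ} (hpol : IsConsistent pol α)
    {V : Finset (Fin U)} (hV : V.Nonempty) {c : ℝ} (hc0 : 0 ≤ c)
    (hc : c < tests U K * ((1 - α) / (2 * d))) (htests : 0 < tests U K) :
    ∃ᶠ t : ℕ in atTop, V.card * c * (1 / ((t : ℝ) + 1)) ≤ ∑ u ∈ V, missProb I pol u t := by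
  by_contra hcon
  rw [not_frequently] at hcon
  have hVpos : (0 : ℝ) < V.card := by exact_mod_cast hV.card_pos
  obtain ⟨C, hC⟩ := exists_sum_le_log (f := fun t => ∑ u ∈ V, missProb I pol u t)
    (fun t => Finset.sum_nonneg fun u _ => missProb_nonneg I pol u t)
    (mul_nonneg hVpos.le hc0) (hcon.mono fun t ht => (not_le.1 ht).le)
  have hC' : ∀ t : ℕ, ∑ u ∈ V, expect (trajLaw I pol t) (misses I u) ≤
      V.card * c * Real.log t + C := by
    intro t
    simp only [expect_misses]
    rw [Finset.sum_comm]
    exact hC t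
  have hnonneg : ∀ u t, 0 ≤ expect (trajLaw I pol t) (misses I u) := fun u t => by
    rw [expect_misses]
    exact Finset.sum_nonneg fun s _ => missProb_nonneg I pol u s
  have hlog : Tendsto (fun t : ℕ => Real.log (t : ℝ)) atTop atTop :=
    Real.tendsto_log_atTop.comp tendsto_natCast_atTop_atTop
  have hsmall : ∀ᶠ t : ℕ in atTop, V.card * c * Real.log t + C ≤ (t : ℝ) / 4 := by
    have h1 : (fun t : ℕ => V.card * c * Real.log t + C) =o[atTop] fun t : ℕ => (t : ℝ) :=
      ((Real.isLittleO_log_id_atTop.comp_tendsto tendsto_natCast_atTop_atTop).const_mul_left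
        _).add (isLittleO_const_left.2 (Or.inr
          (tendsto_norm_atTop_atTop.comp tendsto_natCast_atTop_atTop)))
    filter_upwards [h1.bound (show (0 : ℝ) < 1 / 4 by norm_num)] with t ht
    rw [Real.norm_natCast] at ht
    linarith [Real.le_norm_self (V.card * c * Real.log t + C)]
  have hmiss : ∀ u ∈ V, ∀ᶠ t : ℕ in atTop,
      expect (trajLaw I pol t) (misses I u) ≤ (t : ℝ) / 4 := fun u hu =>
    hsmall.mono fun t ht => ((Finset.single_le_sum (f := fun u =>
      expect (trajLaw I pol t) (misses I u)) (fun v _ => hnonneg v t) hu).trans (hC' t)).trans ht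
  obtain ⟨c₁, h1, h2⟩ := exists_between ((div_lt_iff₀' htests).2 hc)
  rw [div_lt_iff₀' htests] at h1
  have hlow : ∀ᶠ t : ℕ in atTop, ∀ u ∈ V,
      tests U K * (c₁ * Real.log t) ≤ expect (trajLaw I pol t) (misses I u) := by
    rw [Filter.eventually_all_finset]
    exact fun u hu => mul_log_le_misses I q hq hq1 hd0 hd hpol u (hmiss u hu) h2
  have hslack : 0 < V.card * (tests U K * c₁ - c) := mul_pos hVpos (sub_pos.2 h1)
  obtain ⟨t, ht, htl⟩ :=
    (hlow.and (hlog.eventually_gt_atTop (C / (V.card * (tests U K * c₁ - c))))).exists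
  have h3 := (Finset.sum_le_sum ht).trans (hC' t)
  rw [Finset.sum_const, nsmul_eq_mul] at h3
  rw [div_lt_iff₀ hslack] at htl
  linarith

lemma lamMin_nonneg (I : Instance U K) : 0 ≤ I.lamMin := Real.iInf_nonneg fun u => (I.lam u).2.1

lemma lamMin_le (I : Instance U K) (u : Fin U) : I.lamMin ≤ I.lam u :=
  ciInf_le (Set.finite_range _).bddBelow u

lemma muMin_le (I : Instance U K) (u : Fin U) (k : Fin K) : I.muMin ≤ I.mu u k :=
  ciInf_le (f := fun p : Fin U × Fin K => (I.mu p.1 p.2 : ℝ)) (Set.finite_range _).bddBelow (u, k)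

lemma le_muMax (I : Instance U K) (u : Fin U) (k : Fin K) : I.mu u k ≤ I.muMax :=
  le_ciSup (f := fun p : Fin U × Fin K => (I.mu p.1 p.2 : ℝ)) (Set.finite_range _).bddAbove (u, k)

lemma D_nonneg (I : Instance U K) : 0 ≤ I.D := div_nonneg (gap_nonneg I) ENNReal.toReal_nonneg

/-- When `D` is positive, the rate `(muMax + 1) / 2` lies strictly between all service rates and
one, and `D` is the gap divided by a number that bounds the divergence of every
service law from it. -/
lemma exists_rate_of_D_pos (I : Instance U K) (hU : 1 ≤ U) (hD : 0 < I.D) :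
    ∃ (q : unitInterval) (d : ℝ), (∀ u k, I.mu u k < q) ∧ q < 1 ∧ 0 < d ∧
      (∀ u k, coinKL (I.mu u k) q ≤ d) ∧ I.D = I.gap / d := by
  have hd0 : 0 < (bernKL I.muMin ((I.muMax + 1) / 2)).toReal := by
    refine ENNReal.toReal_nonneg.lt_of_ne fun h => ?_
    rw [Instance.D, ← h, div_zero] at hD
    exact lt_irrefl _ hD
  let u₀ : Fin U := ⟨0, hU⟩
  have hmin0 : 0 ≤ I.muMin := Real.iInf_nonneg fun p => (I.mu p.1 p.2).2.1
  have hmax0 : 0 ≤ I.muMax := (I.mu u₀ (I.best u₀)).2.1.trans (le_muMax I _ _)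
  have : Nonempty (Fin U × Fin K) := ⟨(u₀, I.best u₀)⟩
  have hmax1 : I.muMax ≤ 1 := ciSup_le fun p => (I.mu p.1 p.2).2.2
  have hmax : I.muMax < 1 := by
    refine hmax1.lt_of_ne fun h => ?_
    -- with `muMax = 1` the divergence is infinite or zero
    rw [bernKL] at hd0
    split_ifs at hd0 with hif
    · simp at hd0
    · push Not at hif
      have hq : (I.muMax + 1) / 2 = 1 := by rw [h]; norm_num
      rw [hq, hif.2 hq] at hd0
      simp at hd0
  set q : ℝ := (I.muMax + 1) / 2 with hqdef
  have hq0 : 0 < q := by linarith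
  have hq1 : q < 1 := by linarith
  have hd : (bernKL I.muMin q).toReal =
      I.muMin * Real.log (I.muMin / q) + (1 - I.muMin) * Real.log ((1 - I.muMin) / (1 - q)) := by
    have hif : ¬ ((q = 0 ∧ I.muMin ≠ 0) ∨ (q = 1 ∧ I.muMin ≠ 1)) := by
      rintro (h | h)
      · exact hq0.ne' h.1
      · exact hq1.ne h.1
    rw [bernKL, if_neg hif] at hd0 ⊢
    rw [ENNReal.toReal_ofReal]
    by_contra hneg
    rw [ENNReal.ofReal_of_nonpos (not_le.1 hneg).le] at hd0
    simp at hd0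
  have hlt : ∀ u k, (I.mu u k : ℝ) < q := fun u k => by linarith [le_muMax I u k]
  refine ⟨⟨q, hq0.le, hq1.le⟩, (bernKL I.muMin q).toReal, hlt, hq1, hd0, fun u k => ?_, rfl⟩
  rw [coinKL_eq, hd]
  rw [hd] at hd0
  exact bernoulli_divergence_anti hmin0 (muMin_le I u k) (hlt u k).le hq0 hq1 hd0.le

/-- The bound for the sum of the regrets over a set `V` of queues. -/
lemma frequently_le_sum_regret (I : Instance U K) (hU : 1 ≤ U) {α : ℝ} (hα : α < 1)
    {pol : Policy U K} (hpol : IsConsistent pol α) (π : Fin U → PMF ℕ) {V : Finset (Fin U)}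
    (hV : V.Nonempty) {r : ℝ} (hr0 : 0 ≤ r) (hr : r = 0 ∨ r < tests U K / 2) :
    ∃ᶠ t : ℕ in atTop, V.card * (I.lamMin * I.D * (1 - α) * r) * (1 / (t : ℝ)) ≤
      ∑ u ∈ V, regret I pol (π u) u t := by
  suffices h : ∃ᶠ t : ℕ in atTop, V.card * (I.lamMin * I.D * (1 - α) * r) *
      (1 / ((t + 1 : ℕ) : ℝ)) ≤ ∑ u ∈ V, regret I pol (π u) u (t + 1) from
    (tendsto_add_atTop_nat 1).frequently h
  have hreg : ∀ t, I.lamMin * I.gap * ∑ u ∈ V, missProb I pol u t ≤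
      ∑ u ∈ V, regret I pol (π u) u (t + 1) := by
    intro t
    rw [Finset.mul_sum]
    refine Finset.sum_le_sum fun u _ => le_trans ?_ (le_regret I pol (π u) u t)
    exact mul_le_mul_of_nonneg_right
      (mul_le_mul_of_nonneg_right (lamMin_le I u) (gap_nonneg I)) (missProb_nonneg I pol u t)
  have hgl : 0 ≤ I.lamMin * I.gap := mul_nonneg (lamMin_nonneg I) (gap_nonneg I)
  by_cases hzero : I.D = 0 ∨ r = 0
  · refine Frequently.of_forall fun t => ?_
    have h0 : V.card * (I.lamMin * I.D * (1 - α) * r) * (1 / ((t + 1 : ℕ) : ℝ)) = 0 := by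
      rcases hzero with h | h <;> simp [h]
    rw [h0]
    exact (mul_nonneg hgl (Finset.sum_nonneg fun u _ => missProb_nonneg I pol u t)).trans (hreg t)
  · push Not at hzero
    obtain ⟨q, d, hq, hq1, hd0, hd, hDd⟩ :=
      exists_rate_of_D_pos I hU ((D_nonneg I).lt_of_ne hzero.1.symm)
    have hr' := hr.resolve_left hzero.2
    have hα' : 0 < 1 - α := sub_pos.2 hα
    have hfreq := frequently_le_sum_missProb I q hq hq1 hd0 hd hpol hV
      (c := (1 - α) * r / d) (by positivity)
      (by
        rw [show tests U K * ((1 - α) / (2 * d)) = (1 - α) * (tests U K / 2) / d by ring]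
        gcongr) (by linarith)
    refine hfreq.mono fun t ht => le_trans (le_of_eq ?_)
      ((mul_le_mul_of_nonneg_left ht hgl).trans (hreg t))
    rw [hDd]
    push_cast
    ring

end LowerBound

end QueueingBandit

end

open QueueingBandit
theorem mainTheorem2 {U K : ℕ} (hU : 1 ≤ U) (I : Instance U K)
    (α : ℝ) (hα0 : 0 < α) (hα1 : α < 1)
    (pol : Policy U K) (hpol : IsConsistent pol α)
    (π : Fin U → PMF ℕ) (hπ : ∀ u, IsStationary (I.lam u) (I.mu u (I.best u)) (π u)) :
    (∃ᶠ t : ℕ in Filter.atTop,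
      (I.lamMin / 8 * I.D * (1 - α) * ((K : ℝ) - 1)) * (1 / (t : ℝ)) ≤
        1 / (U : ℝ) * ∑ u, regret I pol (π u) u t) ∧
    (∀ u, ∃ᶠ t : ℕ in Filter.atTop,
      (I.lamMin / 8 * I.D * (1 - α) * max ((U : ℝ) - 1) (2 * ((K : ℝ) - (U : ℝ)))) *
        (1 / (t : ℝ)) ≤ regret I pol (π u) u t) ∧
    (U = 1 → ∀ u, ∃ᶠ t : ℕ in Filter.atTop,
      ((I.lam u : ℝ) / 4 * I.D * (1 - α) * ((K : ℝ) - 1)) * (1 / (t : ℝ)) ≤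
        regret I pol (π u) u t) := by
  have hUK : U ≤ K := by simpa using Fintype.card_le_of_injective _ I.best_injective
  have hU' : (1 : ℝ) ≤ U := by exact_mod_cast hU
  have hUK' : (U : ℝ) ≤ K := by exact_mod_cast hUK
  have hUpos : (0 : ℝ) < U := by linarith
  have hl : ((U : ℝ) - 1) / 2 ≤ tests U K := le_max_left _ _
  have hr : (K : ℝ) - U ≤ tests U K := le_max_right _ _
  have hb : ∀ u, ∃ᶠ t : ℕ in Filter.atTop,
      (I.lamMin / 8 * I.D * (1 - α) * max ((U : ℝ) - 1) (2 * ((K : ℝ) - (U : ℝ)))) *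
        (1 / (t : ℝ)) ≤ regret I pol (π u) u t := by
    intro u
    have htwo : max ((U : ℝ) - 1) (2 * ((K : ℝ) - U)) = 2 * tests U K := by
      rw [tests, mul_max_of_nonneg _ _ zero_le_two, mul_div_cancel₀ _ two_ne_zero]
    have h := frequently_le_sum_regret I hU hα1 hpol π (Finset.singleton_nonempty u)
      (r := tests U K / 4) (by linarith)
      ((show 0 ≤ tests U K by linarith).eq_or_lt.imp (fun h => by rw [← h, zero_div])
        fun h => by linarith)
    refine h.mono fun t ht => ?_
    rw [Finset.sum_singleton, Finset.card_singleton, Nat.cast_one, one_mul] at ht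
    refine le_trans (le_of_eq ?_) ht
    rw [htwo]
    ring
  refine ⟨?_, hb, ?_⟩
  · have : NeZero U := ⟨by omega⟩
    -- `K - 1 = (U - 1) + (K - U)` is at most three times `tests U K`
    have h := frequently_le_sum_regret I hU hα1 hpol π (Finset.univ_nonempty (α := Fin U))
      (r := ((K : ℝ) - 1) / 8) (by linarith)
      ((show 0 ≤ (K : ℝ) - 1 by linarith).eq_or_lt.imp (fun h => by rw [← h, zero_div])
        fun h => by linarith)
    refine h.mono fun t ht => ?_
    rw [Finset.card_univ, Fintype.card_fin] at ht
    rw [one_div (U : ℝ), ← div_eq_inv_mul, le_div_iff₀ hUpos]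
    refine le_trans (le_of_eq ?_) ht
    ring
  · rintro rfl u
    have hlam : I.lamMin = I.lam u := by
      rw [Instance.lamMin, ciInf_unique, Subsingleton.elim u default]
    refine (hb u).mono fun t ht => le_trans (le_of_eq ?_) ht
    rw [hlam, max_eq_right (by push_cast; linarith)]
    push_cast
    ring
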